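/- Let $k$ be a field, $R = k[x_1,\dots,x_r]$ with the standard grading, and let $I \subset R$ be a homogeneous ideal containing no nonzero linear form such that $A = R/I$ is an artinian Gorenstein algebra (i.e. $A$ is artinian and its socle $\{a \in A : x_1a = \dots = x_ra = 0\}$ is one-dimensional over $k$). Assume that $I$ contains a regular sequence of $r$ quadrics (forms of degree 2). Let $h_i = \dim_k [A]_i$ be the Hilbert function of $A$, let $e$ be its socle degree (the last degree in which $h_i \neq 0$), and let $\nu$ be the number of quadrics in a minimal set of homogeneous generators of $I$. Then: 1. $h_2 = \binom{r+1}{2} - \nu$. 2. $\nu \geq r$. 3. $e \le r$. Moreover, $e = r$ if and only if $A$ is a complete intersection of quadrics (i.e. $I$ is generated by a regular sequence of $r$ quadrics); equivalently, $\nu = r$ and all minimal generators of $I$ are quadrics. In this case $h_i = \binom{r}{i}$ for all $i \ge 0$. 4. If $A$ is not a complete intersection of quadrics, then $e < r$. 5. If, in addition, all minimal generators of $I$ are quadrics, then $\nu \neq r+1$; that is, $h_2 \neq \binom{r}{2} - 1$. -/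

import Mathlib

noncomputable section

namespace GorensteinQuadrics

open MvPolynomial

attribute [local instance] MvPolynomial.gradedAlgebra

variable {k : Type*} [Field k] {r : ℕ}

/-- The Hilbert function (h-vector) of the quotient `R / I` of `R = k[x₁, …, x_r]` by a homogeneous
ideal: `h_i` is the dimension of the degree `i` component of `R / I`, that is, of the image of the
space of forms of degree `i`. -/
def hilbertFunction (I : Ideal (MvPolynomial (Fin r) k)) (i : ℕ) : ℕ :=
  Module.finrank k
    ((homogeneousSubmodule (Fin r) k i).map (Ideal.Quotient.mkₐ k I).toLinearMap)

/-- `e` is the socle degree of the artinian algebra `R / I`: the last degree in which the Hilbert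
function is nonzero. -/
def IsSocleDegree (I : Ideal (MvPolynomial (Fin r) k)) (e : ℕ) : Prop :=
  IsGreatest {i : ℕ | hilbertFunction I i ≠ 0} e

/-- The socle of `R / I`: the annihilator in `R / I` of the ideal `(x₁, …, x_r)`. -/
def socle (I : Ideal (MvPolynomial (Fin r) k)) : Submodule k (MvPolynomial (Fin r) k ⧸ I) :=
  ⨅ i : Fin r, LinearMap.ker (LinearMap.mulLeft k (Ideal.Quotient.mk I (X i)))

/-- `R / I` is a standard graded artinian Gorenstein algebra: `I` is homogeneous, `R / I` is
artinian, and its socle is one-dimensional over `k`. -/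
structure IsArtinianGorenstein (I : Ideal (MvPolynomial (Fin r) k)) : Prop where
  isHomogeneous : I.IsHomogeneous (homogeneousSubmodule (Fin r) k)
  isArtinianRing : IsArtinianRing (MvPolynomial (Fin r) k ⧸ I)
  finrank_socle : Module.finrank k (socle I) = 1

/-- `q` is a regular sequence of `r` quadrics in the polynomial ring in `r` variables. -/
def IsRegularSequenceOfQuadrics (q : Fin r → MvPolynomial (Fin r) k) : Prop :=
  (∀ i, (q i).IsHomogeneous 2) ∧
    RingTheory.Sequence.IsRegular (MvPolynomial (Fin r) k) (List.ofFn q)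

/-- `I` contains no nonzero linear form. -/
def ContainsNoLinearForm (I : Ideal (MvPolynomial (Fin r) k)) : Prop :=
  ∀ f ∈ I, f.IsHomogeneous 1 → f = 0

/-- `I` contains a regular sequence of `r` quadrics. -/
def ContainsRegularSequenceOfQuadrics (I : Ideal (MvPolynomial (Fin r) k)) : Prop :=
  ∃ q : Fin r → MvPolynomial (Fin r) k, IsRegularSequenceOfQuadrics q ∧ ∀ i, q i ∈ I

/-- `R / I` is an artinian complete intersection of quadrics: `I` is generated by a regular
sequence of `r` quadrics. -/
def IsCompleteIntersectionOfQuadrics (I : Ideal (MvPolynomial (Fin r) k)) : Prop :=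
  ∃ q : Fin r → MvPolynomial (Fin r) k, IsRegularSequenceOfQuadrics q ∧
    Ideal.span (Set.range q) = I

/-- `G` is a set of minimal (homogeneous) generators of `I`: it consists of forms, it generates
`I`, and no proper subset of `G` generates `I`. -/
structure IsMinimalGenerators (I : Ideal (MvPolynomial (Fin r) k))
    (G : Set (MvPolynomial (Fin r) k)) : Prop where
  isHomogeneous : ∀ g ∈ G, ∃ d : ℕ, g.IsHomogeneous d
  span_eq : Ideal.span G = I
  minimal : ∀ G' ⊂ G, Ideal.span G' ≠ I

end GorensteinQuadrics

end

/-!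
Let `R = k[x₁, …, x_r]`, let `q` be the regular sequence of `r` quadrics in `I`, and put `J = (q)`,
`B = R / J` and `A = R / I`. Everything rests on a comparison of `A` with the complete intersection
`B`, about which two facts are needed.

* `B` has Hilbert series `(1 + X) ^ r`. A regular element of degree `d` multiplies the Hilbert
  series by `1 - X ^ d` (`hilbertSeries_ofList`); applied to the variables this computes the series
  of `R`, applied to `q` it computes that of `B`.
* The socle of `B` is one-dimensional (`finrank_socle_eq_one`). It is `Hom(k, R / (q))`, which
  dimension shifting identifies with `Ext ^ r (k, R)`, and likewise `Hom(k, R / (x₁, …, x_r))`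
  (`ext_of_isWeaklyRegular`).

In a graded algebra with one-dimensional socle every form outside the ideal has a multiple of socle
degree outside the ideal (`exists_mul_notMem`), so multiplication into the socle degree is a perfect
pairing. Hence the Hilbert function is symmetric, and so are the ranks of multiplication by a form
(`mulRank_eq_mulRank`).

Since `A` is a quotient of `B`, its socle degree is at most `r`; if it is `r`, then the ideal
`I / J` misses the socle of `B`, so it is zero. The minimal generators of degree `2` form a basis of
the degree `2` part of `I`, because `I` has no nonzero elements of smaller degree; this relates `ν`
to `h₂`. Finally, if `I` is generated by `r + 1` quadrics, then `I = J + (f)` for a quadric `f`, and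
the two dualities give `H_A = (1 - X ^ 2) (1 + X) ^ r + X ^ (r - e + 2) H_A`. As `e < r`, a
primitive root of unity of order `r - e + 2 ≥ 3` contradicts this identity
(`false_of_sup_span_singleton`).
-/

namespace GorensteinQuadrics

open MvPolynomial RingTheory.Sequence

attribute [local instance] MvPolynomial.gradedAlgebra

universe u

/-! ### Regular sequences and `Ext` -/

section Ext

open CategoryTheory CategoryTheory.Abelian

variable {S : Type u} [CommRing S]

/-- Elements annihilating `N` act as zero on `Ext N M n`. -/
lemma ext_smul_eq_zero {N M : ModuleCat.{u} S} {a : S} (ha : a ∈ Module.annihilator S N) {n : ℕ}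
    (x : Ext N M n) : a • x = 0 := by
  have h0 : a • 𝟙 N = 0 := by
    ext y
    exact Module.mem_annihilator.mp ha y
  have : a • x = (Ext.mk₀ (a • 𝟙 N)).comp x (zero_add n) := by simp [Ext.mk₀_smul]
  rw [this, h0]
  simp

/-- Dimension shifting along a weakly `M`-regular sequence `rs` that annihilates `N`: the groups
`Ext N M i` vanish for `i < rs.length`, and the first one that may survive is `Hom(N, M / rs M)`.
In particular the latter depends on `rs` only through its length. -/
lemma ext_of_isWeaklyRegular (N : ModuleCat.{u} S) (rs : List S) (M : ModuleCat.{u} S)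
    (hrs : IsWeaklyRegular M rs) (hN : ∀ a ∈ rs, a ∈ Module.annihilator S N) :
    (∀ i < rs.length, Subsingleton (Ext N M i)) ∧
      Nonempty (Ext N M rs.length ≃ₗ[S]
        (N →ₗ[S] (M ⧸ (Ideal.ofList rs • ⊤ : Submodule S M)))) := by
  induction rs generalizing M with
  | nil =>
    refine ⟨by simp, ⟨?_⟩⟩
    have hbot : (Ideal.ofList ([] : List S) • ⊤ : Submodule S M) = ⊥ := by simp
    exact (Ext.linearEquiv₀ (R := S)).trans ((ModuleCat.homLinearEquiv (R := S) (S := S)).trans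
      (LinearEquiv.congrRight (Submodule.quotEquivOfEqBot _ hbot).symm))
  | cons a rs ih =>
    rw [isWeaklyRegular_cons_iff] at hrs
    obtain ⟨ha, hrs⟩ := hrs
    have haN := hN a (by simp)
    obtain ⟨ih1, ⟨ih2⟩⟩ := ih (ModuleCat.of S (QuotSMulTop a M)) hrs
      (fun b hb => hN b (by simp [hb]))
    -- `0 → M → M → M / aM → 0`, whose first map induces zero on `Ext N`
    have hS := ha.smulShortComplex_shortExact
    have hf : ∀ {n : ℕ} (x : Ext N M n),
        x.comp (Ext.mk₀ (ModuleCat.smulShortComplex M a).f) (add_zero n) = 0 := by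
      intro n x
      change x.comp (Ext.mk₀ (a • 𝟙 M)) (add_zero n) = 0
      rw [Ext.mk₀_smul, Ext.comp_smul]
      exact ext_smul_eq_zero haN _
    have hvan : ∀ i < rs.length + 1, Subsingleton (Ext N M i) := by
      intro i hi
      refine subsingleton_of_forall_eq 0 fun x => ?_
      match i with
      | 0 =>
        have hmono : Mono (ModuleCat.smulShortComplex M a).f := hS.mono_f
        refine Ext.postcomp_mk₀_injective_of_mono N (ModuleCat.smulShortComplex M a).f ?_
        exact (hf x).trans (map_zero _).symm
      | i + 1 =>
        obtain ⟨x₃, rfl⟩ := Ext.covariant_sequence_exact₁ N hS x (hf x) rfl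
        have := ih1 i (by omega)
        have h3 : x₃ = 0 := @Subsingleton.elim _ this _ _
        rw [h3, Ext.zero_comp]
        rfl
    refine ⟨by simpa using hvan, ⟨?_⟩⟩
    -- the connecting map, injective since `Ext N M rs.length` vanishes
    have hbij : Function.Bijective (Ext.postcompOfLinear hS.extClass S N
        (rfl : rs.length + 1 = rs.length + 1)) := by
      constructor
      · rw [← LinearMap.ker_eq_bot, LinearMap.ker_eq_bot']
        intro x₃ hx
        obtain ⟨x₂, rfl⟩ := Ext.covariant_sequence_exact₃ N hS x₃ rfl hx
        have := hvan rs.length (by omega)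
        have h2 : x₂ = 0 := @Subsingleton.elim _ this _ _
        rw [h2, Ext.zero_comp]
      · intro x
        obtain ⟨x₃, h⟩ := Ext.covariant_sequence_exact₁ N hS x (hf x) rfl
        exact ⟨x₃, h⟩
    exact (LinearEquiv.ofBijective _ hbij).symm.trans (ih2.trans
      (LinearEquiv.congrRight (Submodule.quotOfListConsSMulTopEquivQuotSMulTopInner M a rs).symm))

lemma nonempty_linearEquiv_of_isWeaklyRegular (N : Type u) [AddCommGroup N] [Module S N]
    {rs rs' : List S}
    (hrs : IsWeaklyRegular S rs) (hrs' : IsWeaklyRegular S rs') (hlen : rs.length = rs'.length)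
    (hN : ∀ a ∈ rs, a ∈ Module.annihilator S N) (hN' : ∀ a ∈ rs', a ∈ Module.annihilator S N) :
    Nonempty ((N →ₗ[S] (S ⧸ Ideal.ofList rs)) ≃ₗ[S] (N →ₗ[S] (S ⧸ Ideal.ofList rs'))) := by
  obtain ⟨-, ⟨e⟩⟩ := ext_of_isWeaklyRegular (ModuleCat.of S N) rs (ModuleCat.of S S) hrs hN
  obtain ⟨-, ⟨e'⟩⟩ := ext_of_isWeaklyRegular (ModuleCat.of S N) rs' (ModuleCat.of S S) hrs' hN'
  rw [hlen] at e
  have htop : ∀ l : List S, (Ideal.ofList l • ⊤ : Submodule S S) = Ideal.ofList l := by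
    intro l
    rw [smul_eq_mul, Ideal.mul_top]
  exact ⟨(LinearEquiv.congrRight (Submodule.quotEquivOfEq _ _ (htop rs).symm)).trans
    (e.symm.trans (e'.trans (LinearEquiv.congrRight (Submodule.quotEquivOfEq _ _ (htop rs')))))⟩

end Ext

/-! ### The socle of a complete intersection -/

lemma ofList_ofFn {S : Type*} [CommRing S] {n : ℕ} (q : Fin n → S) :
    Ideal.ofList (List.ofFn q) = Ideal.span (Set.range q) := by
  simp only [Ideal.ofList, List.mem_ofFn']
  rfl

variable {k : Type u} [Field k] {r : ℕ}

lemma mem_span_X_iff {f : MvPolynomial (Fin r) k} :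
    f ∈ Ideal.span (Set.range (X : Fin r → MvPolynomial (Fin r) k)) ↔
      constantCoeff f = 0 := by
  rw [← Set.image_univ, mem_ideal_span_X_image, constantCoeff_eq]
  constructor
  · intro h
    by_contra h0
    obtain ⟨i, -, hi⟩ := h 0 (mem_support_iff.mpr h0)
    simp at hi
  · intro h d hd
    by_contra! hcon
    have : d = 0 := Finsupp.ext fun i => hcon i (Set.mem_univ i)
    subst this
    exact mem_support_iff.mp hd h

lemma mem_span_X_of_isHomogeneous {f : MvPolynomial (Fin r) k} {d : ℕ} (hf : f.IsHomogeneous d)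
    (hd : d ≠ 0) : f ∈ Ideal.span (Set.range (X : Fin r → MvPolynomial (Fin r) k)) := by
  rw [mem_span_X_iff, constantCoeff_eq]
  exact hf.coeff_eq_zero (by simpa using hd.symm)

lemma isWeaklyRegular_X :
    IsWeaklyRegular (MvPolynomial (Fin r) k)
      (List.ofFn (X : Fin r → MvPolynomial (Fin r) k)) := by
  refine ⟨fun i hi => ?_⟩
  have hi' : i < r := by simpa using hi
  have hspan : (Ideal.ofList ((List.ofFn (X : Fin r → MvPolynomial (Fin r) k)).take i) • ⊤ :
      Submodule (MvPolynomial (Fin r) k) (MvPolynomial (Fin r) k)) =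
      Ideal.span (X '' {j : Fin r | j.1 < i}) := by
    rw [smul_eq_mul, Ideal.mul_top, Ideal.ofList]
    congr 1
    ext f
    simp only [List.mem_take_iff_getElem, Set.mem_ofPred_eq, Set.mem_image, List.getElem_ofFn,
      List.length_ofFn]
    constructor
    · rintro ⟨j, hj, rfl⟩
      exact ⟨⟨j, by omega⟩, by simp; omega, rfl⟩
    · rintro ⟨j, hj, rfl⟩
      exact ⟨j, by simp; omega, rfl⟩
  rw [isSMulRegular_quotient_iff_mem_of_smul_mem, hspan]
  intro f hf
  rw [mem_ideal_span_X_image] at hf ⊢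
  intro d hd
  obtain ⟨j, hj, hj0⟩ := hf (Finsupp.single ⟨i, hi'⟩ 1 + d) (by
    rw [List.getElem_ofFn, mem_support_iff, smul_eq_mul, coeff_X_mul]
    exact mem_support_iff.mp hd)
  refine ⟨j, hj, ?_⟩
  have hne : (⟨i, hi'⟩ : Fin r) ≠ j := by
    rintro rfl
    simp at hj
  simpa [Finsupp.single_apply, hne] using hj0

/-- A complete intersection of `r` elements of the ideal `(x₁, …, x_r)` has a one-dimensional
socle: the socle is `Hom(k, R / (q))`, which by dimension shifting is the same for the regular
sequence `q` and for the sequence of variables, where it is `Hom(k, k)`. -/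
lemma finrank_socle_eq_one {q : Fin r → MvPolynomial (Fin r) k}
    (hq : IsWeaklyRegular (MvPolynomial (Fin r) k) (List.ofFn q))
    (hm : ∀ i, q i ∈ Ideal.span (Set.range (X : Fin r → MvPolynomial (Fin r) k))) :
    Module.finrank k (socle (Ideal.span (Set.range q))) = 1 := by
  set m := Ideal.span (Set.range (X : Fin r → MvPolynomial (Fin r) k)) with hmdef
  set J := Ideal.span (Set.range q) with hJ
  obtain ⟨e⟩ := nonempty_linearEquiv_of_isWeaklyRegular (MvPolynomial (Fin r) k ⧸ m) hq
    isWeaklyRegular_X (by simp)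
    (by
      intro a ha
      rw [Ideal.annihilator_quotient]
      obtain ⟨i, rfl⟩ := (List.mem_ofFn' _ _).mp ha
      exact hm i)
    (by
      intro a ha
      rw [Ideal.annihilator_quotient]
      obtain ⟨i, rfl⟩ := (List.mem_ofFn' _ _).mp ha
      exact Ideal.subset_span ⟨i, rfl⟩)
  rw [ofList_ofFn, ofList_ofFn, ← hJ, ← hmdef] at e
  have hsmul : ∀ (f : MvPolynomial (Fin r) k) (w : MvPolynomial (Fin r) k ⧸ J),
      f • w = Ideal.Quotient.mk J f * w := fun f w => Algebra.smul_def f w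
  have hsoc : ∀ w : MvPolynomial (Fin r) k ⧸ J,
      w ∈ socle J ↔ ∀ i, (X i : MvPolynomial (Fin r) k) • w = 0 := by
    intro w
    simp [socle, hsmul, Submodule.mem_iInf]
  have hmk : ∀ {I : Ideal (MvPolynomial (Fin r) k)} (f : MvPolynomial (Fin r) k),
      Ideal.Quotient.mk I f = f • (1 : MvPolynomial (Fin r) k ⧸ I) := by
    intro I f
    change _ = Ideal.Quotient.mk I (f * 1)
    rw [mul_one]
  -- homomorphisms out of `R / m` are determined by the image of `1`
  have hext : ∀ φ ψ : (MvPolynomial (Fin r) k ⧸ m) →ₗ[MvPolynomial (Fin r) k]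
      (MvPolynomial (Fin r) k ⧸ J), φ 1 = ψ 1 → φ = ψ := by
    intro φ ψ h
    ext
    exact h
  have hext' : ∀ φ ψ : (MvPolynomial (Fin r) k ⧸ m) →ₗ[MvPolynomial (Fin r) k]
      (MvPolynomial (Fin r) k ⧸ m), φ 1 = ψ 1 → φ = ψ := by
    intro φ ψ h
    ext
    exact h
  set v := e.symm LinearMap.id with hv
  have hv1 : v 1 ∈ socle J := by
    rw [hsoc]
    intro i
    rw [← map_smul, ← hmk, Ideal.Quotient.eq_zero_iff_mem.mpr
      (hmdef ▸ Ideal.subset_span (Set.mem_range_self i)), map_zero]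
  rw [finrank_eq_one_iff']
  refine ⟨⟨v 1, hv1⟩, ?_, ?_⟩
  · intro h0
    have h1 : v 1 = 0 := congrArg Subtype.val h0
    have h2 : v = 0 := hext _ _ (by simpa using h1)
    have h3 : (LinearMap.id : (MvPolynomial (Fin r) k ⧸ m) →ₗ[MvPolynomial (Fin r) k]
      (MvPolynomial (Fin r) k ⧸ m)) = 0 := by
      rw [hv] at h2
      simpa using h2
    have h4 : (1 : MvPolynomial (Fin r) k ⧸ m) = 0 := LinearMap.congr_fun h3 1
    have h5 : (1 : MvPolynomial (Fin r) k) ∈ m := by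
      rw [← Ideal.Quotient.eq_zero_iff_mem, map_one, h4]
    rw [mem_span_X_iff, map_one] at h5
    exact one_ne_zero h5
  · rintro ⟨w, hw⟩
    rw [hsoc] at hw
    let φ : (MvPolynomial (Fin r) k ⧸ m) →ₗ[MvPolynomial (Fin r) k]
        (MvPolynomial (Fin r) k ⧸ J) :=
      Submodule.liftQ m (LinearMap.toSpanSingleton (MvPolynomial (Fin r) k)
        (MvPolynomial (Fin r) k ⧸ J) w) (by
          rw [hmdef, Ideal.span, Submodule.span_le]
          rintro _ ⟨i, rfl⟩
          simpa using hw i)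
    have hφ : φ 1 = w := by
      change (1 : MvPolynomial (Fin r) k) • w = w
      rw [one_smul]
    obtain ⟨c, hc⟩ := Ideal.Quotient.mk_surjective (e φ 1)
    have hc' : Ideal.Quotient.mk m c = Ideal.Quotient.mk m (C (constantCoeff c)) := by
      rw [Ideal.Quotient.eq, mem_span_X_iff]
      simp
    have he : e φ = (C (constantCoeff c) : MvPolynomial (Fin r) k) • LinearMap.id := by
      apply hext'
      rw [← hc, hc', hmk]
      rfl
    have hφ' : φ = (C (constantCoeff c) : MvPolynomial (Fin r) k) • v := by
      apply e.injective
      rw [he, map_smul, hv, LinearEquiv.apply_symm_apply]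
    refine ⟨constantCoeff c, Subtype.ext ?_⟩
    change constantCoeff c • v 1 = w
    rw [← hφ, hφ', LinearMap.smul_apply, ← algebraMap_eq, algebraMap_smul]

/-! ### Hilbert functions -/

instance (n : ℕ) : Module.Finite k (homogeneousSubmodule (Fin r) k n) :=
  Module.Finite.iff_fg.mpr (homogeneousSubmodule_fg (Fin r) k n)

/-- The rank of multiplication by `f` from the forms of degree `i` to `R / I`. -/
noncomputable def mulRank (I : Ideal (MvPolynomial (Fin r) k)) (f : MvPolynomial (Fin r) k)
    (i : ℕ) : ℕ :=
  Module.finrank k ((homogeneousSubmodule (Fin r) k i).map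
    ((Ideal.Quotient.mkₐ k I).toLinearMap ∘ₗ LinearMap.mulLeft k f))

lemma mulRank_one (I : Ideal (MvPolynomial (Fin r) k)) (i : ℕ) :
    mulRank I 1 i = hilbertFunction I i := by
  rw [mulRank, hilbertFunction, LinearMap.mulLeft_one, LinearMap.comp_id]

/-- Rank-nullity for the restriction of a linear map to a finite-dimensional subspace. -/
lemma finrank_map_add_finrank_inf_ker {V W : Type*} [AddCommGroup V] [Module k V]
    [AddCommGroup W] [Module k W] (p : Submodule k V) [Module.Finite k p] (F : V →ₗ[k] W) :
    Module.finrank k (p.map F) + Module.finrank k ↥(p ⊓ LinearMap.ker F) = Module.finrank k p := by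
  have h := LinearMap.finrank_range_add_finrank_ker (F.domRestrict p)
  rw [LinearMap.range_domRestrict, LinearMap.ker_domRestrict] at h
  rw [← h]
  congr 1
  have : (LinearMap.ker F).submoduleOf p = (p ⊓ LinearMap.ker F).submoduleOf p := by
    ext x
    simp [Submodule.submoduleOf]
  rw [← (Submodule.submoduleOfEquivOfLe (inf_le_left : p ⊓ LinearMap.ker F ≤ p)).finrank_eq,
    ← this]
  rfl

/-- The rank of a bilinear form does not depend on the side from which it is computed. -/
lemma finrank_range_flip {U V : Type*} [AddCommGroup U] [Module k U] [AddCommGroup V] [Module k V]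
    [Module.Finite k V] (β : U →ₗ[k] V →ₗ[k] k) :
    Module.finrank k (LinearMap.range β.flip) = Module.finrank k (LinearMap.range β) := by
  have h : β.flip = LinearMap.dualMap β ∘ₗ (Module.evalEquiv k V).toLinearMap := by
    ext v u
    simp
  have h2 := LinearMap.finrank_range_dualMap_eq_finrank_range (K := k) β
  rw [← h2, h, LinearMap.range_comp_of_range_eq_top _ (LinearEquiv.range _)]

/-- The degree `n` component of a multiple of a form. -/
lemma homogeneousComponent_mul_of_isHomogeneous {f g : MvPolynomial (Fin r) k} {d : ℕ}
    (hf : f.IsHomogeneous d) (i : ℕ) :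
    homogeneousComponent (i + d) (f * g) = f * homogeneousComponent i g := by
  classical
  conv_lhs => rw [← sum_homogeneousComponent g, Finset.mul_sum, map_sum]
  have : ∀ j, homogeneousComponent (i + d) (f * homogeneousComponent j g) =
      if i = j then f * homogeneousComponent j g else 0 := by
    intro j
    have hj : f * homogeneousComponent j g ∈ homogeneousSubmodule (Fin r) k (j + d) := by
      rw [add_comm]
      exact hf.mul (homogeneousComponent_isHomogeneous j g)
    rw [homogeneousComponent_of_mem hj]
    simp
  simp only [this]
  rw [Finset.sum_ite_eq]
  split_ifs with h
  · rfl
  · rw [homogeneousComponent_eq_zero i g (by simpa using h), mul_zero]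

lemma homogeneousComponent_mul_of_lt {f g : MvPolynomial (Fin r) k} {d : ℕ}
    (hf : f.IsHomogeneous d) {i : ℕ} (hi : i < d) :
    homogeneousComponent i (f * g) = 0 := by
  conv_lhs => rw [← sum_homogeneousComponent g, Finset.mul_sum, map_sum]
  refine Finset.sum_eq_zero fun j _ => ?_
  have hj : f * homogeneousComponent j g ∈ homogeneousSubmodule (Fin r) k (d + j) :=
    hf.mul (homogeneousComponent_isHomogeneous j g)
  rw [homogeneousComponent_of_mem hj, if_neg (by omega)]

lemma homogeneousComponent_self {f : MvPolynomial (Fin r) k} {d : ℕ}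
    (hf : f.IsHomogeneous d) : homogeneousComponent d f = f := by
  rw [homogeneousComponent_of_mem (m := d) hf, if_pos rfl]

/-- The Hilbert functions of `R / J` and of its quotient `R / K` differ in degree `n` by the
dimension of the degree `n` part of `K / J`. -/
lemma hilbertFunction_add_finrank_ker {J K : Ideal (MvPolynomial (Fin r) k)} (hJK : J ≤ K)
    (n : ℕ) :
    hilbertFunction K n + Module.finrank k ↥((homogeneousSubmodule (Fin r) k n).map
      (Ideal.Quotient.mkₐ k J).toLinearMap ⊓
        LinearMap.ker (Ideal.Quotient.factorₐ k hJK).toLinearMap) = hilbertFunction J n := by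
  have h := finrank_map_add_finrank_inf_ker
    ((homogeneousSubmodule (Fin r) k n).map (Ideal.Quotient.mkₐ k J).toLinearMap)
    (Ideal.Quotient.factorₐ k hJK).toLinearMap
  rw [← Submodule.map_comp] at h
  exact h

/-- `h_{R/(J, f)}(i + d) = h_{R/J}(i + d) - rank(f : [R/J]_i → [R/J]_{i+d})`. -/
lemma hilbertFunction_sup_add_mulRank {J : Ideal (MvPolynomial (Fin r) k)}
    (hJ : J.IsHomogeneous (homogeneousSubmodule (Fin r) k)) {f : MvPolynomial (Fin r) k} {d : ℕ}
    (hf : f.IsHomogeneous d) (i : ℕ) :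
    hilbertFunction (J ⊔ Ideal.span {f}) (i + d) + mulRank J f i =
      hilbertFunction J (i + d) := by
  set K := J ⊔ Ideal.span {f}
  have hJK : J ≤ K := le_sup_left
  rw [← hilbertFunction_add_finrank_ker hJK, mulRank]
  suffices hker : (homogeneousSubmodule (Fin r) k i).map
      ((Ideal.Quotient.mkₐ k J).toLinearMap ∘ₗ LinearMap.mulLeft k f) =
      (homogeneousSubmodule (Fin r) k (i + d)).map (Ideal.Quotient.mkₐ k J).toLinearMap ⊓
        LinearMap.ker (Ideal.Quotient.factorₐ k hJK).toLinearMap by rw [hker]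
  ext x
  constructor
  · rintro ⟨g, hg, rfl⟩
    refine ⟨⟨f * g, ?_, rfl⟩, ?_⟩
    · rw [SetLike.mem_coe, add_comm]
      exact hf.mul hg
    · change Ideal.Quotient.mk K (f * g) = 0
      exact Ideal.Quotient.eq_zero_iff_mem.mpr
        (Ideal.mul_mem_right _ _ (Ideal.mem_sup_right (Ideal.mem_span_singleton_self f)))
  · rintro ⟨⟨g, hg, rfl⟩, hx⟩
    have hgK : g ∈ K := Ideal.Quotient.eq_zero_iff_mem.mp hx
    obtain ⟨a, ha, b, hb, rfl⟩ := Submodule.mem_sup.mp hgK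
    obtain ⟨c, rfl⟩ := Ideal.mem_span_singleton'.mp hb
    refine ⟨homogeneousComponent i c, homogeneousComponent_isHomogeneous i c, ?_⟩
    change Ideal.Quotient.mk J (f * homogeneousComponent i c) = Ideal.Quotient.mk J (a + c * f)
    rw [← homogeneousComponent_self hg, map_add, mul_comm c f,
      homogeneousComponent_mul_of_isHomogeneous hf, map_add,
      Ideal.Quotient.eq_zero_iff_mem.mpr (homogeneousComponent_mem_of_mem hJ ha _), zero_add]

lemma hilbertFunction_sup_of_lt {J : Ideal (MvPolynomial (Fin r) k)}
    (hJ : J.IsHomogeneous (homogeneousSubmodule (Fin r) k)) {f : MvPolynomial (Fin r) k} {d : ℕ}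
    (hf : f.IsHomogeneous d) {i : ℕ} (hi : i < d) :
    hilbertFunction (J ⊔ Ideal.span {f}) i = hilbertFunction J i := by
  set K := J ⊔ Ideal.span {f}
  have hJK : J ≤ K := le_sup_left
  rw [← hilbertFunction_add_finrank_ker hJK]
  suffices hbot : (homogeneousSubmodule (Fin r) k i).map (Ideal.Quotient.mkₐ k J).toLinearMap ⊓
      LinearMap.ker (Ideal.Quotient.factorₐ k hJK).toLinearMap = ⊥ by
    rw [hbot, finrank_bot, add_zero]
  rw [eq_bot_iff]
  rintro _ ⟨⟨g, hg, rfl⟩, hx⟩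
  have hgK : g ∈ K := Ideal.Quotient.eq_zero_iff_mem.mp hx
  obtain ⟨a, ha, b, hb, rfl⟩ := Submodule.mem_sup.mp hgK
  obtain ⟨c, rfl⟩ := Ideal.mem_span_singleton'.mp hb
  change Ideal.Quotient.mk J (a + c * f) = 0
  rw [← homogeneousComponent_self hg, map_add, mul_comm c f,
    homogeneousComponent_mul_of_lt hf hi, add_zero,
    Ideal.Quotient.eq_zero_iff_mem.mpr (homogeneousComponent_mem_of_mem hJ ha _)]

lemma hilbertFunction_anti {J I : Ideal (MvPolynomial (Fin r) k)} (hJI : J ≤ I) (n : ℕ) :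
    hilbertFunction I n ≤ hilbertFunction J n := by
  rw [← hilbertFunction_add_finrank_ker hJI]
  exact Nat.le_add_right _ _

/-- The Hilbert functions of `J ≤ I` agree in degree `n` only if the ideals do. -/
lemma mem_of_hilbertFunction_eq {J I : Ideal (MvPolynomial (Fin r) k)} (hJI : J ≤ I) {n : ℕ}
    (h : hilbertFunction I n = hilbertFunction J n) {f : MvPolynomial (Fin r) k} (hf : f ∈ I)
    (hfn : f.IsHomogeneous n) : f ∈ J := by
  rw [← hilbertFunction_add_finrank_ker hJI] at h
  have h0 := Nat.left_eq_add.mp h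
  rw [Submodule.finrank_eq_zero] at h0
  have hmem : Ideal.Quotient.mk J f ∈ (homogeneousSubmodule (Fin r) k n).map
      (Ideal.Quotient.mkₐ k J).toLinearMap ⊓
        LinearMap.ker (Ideal.Quotient.factorₐ k hJI).toLinearMap :=
    ⟨⟨f, hfn, rfl⟩, Ideal.Quotient.eq_zero_iff_mem.mpr hf⟩
  rw [h0] at hmem
  exact Ideal.Quotient.eq_zero_iff_mem.mp hmem

lemma hilbertFunction_eq_zero_iff {I : Ideal (MvPolynomial (Fin r) k)} {n : ℕ} :
    hilbertFunction I n = 0 ↔ ∀ f : MvPolynomial (Fin r) k, f.IsHomogeneous n → f ∈ I := by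
  rw [hilbertFunction, Submodule.finrank_eq_zero, Submodule.eq_bot_iff]
  constructor
  · intro h f hf
    exact Ideal.Quotient.eq_zero_iff_mem.mp (h _ ⟨f, hf, rfl⟩)
  · rintro h _ ⟨f, hf, rfl⟩
    exact Ideal.Quotient.eq_zero_iff_mem.mpr (h f hf)

lemma mulRank_of_isSMulRegular {J : Ideal (MvPolynomial (Fin r) k)} {f : MvPolynomial (Fin r) k}
    (hf : ∀ g, f * g ∈ J → g ∈ J) (i : ℕ) : mulRank J f i = hilbertFunction J i := by
  have h1 := finrank_map_add_finrank_inf_ker (homogeneousSubmodule (Fin r) k i)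
    ((Ideal.Quotient.mkₐ k J).toLinearMap ∘ₗ LinearMap.mulLeft k f)
  have h2 := finrank_map_add_finrank_inf_ker (homogeneousSubmodule (Fin r) k i)
    (Ideal.Quotient.mkₐ k J).toLinearMap
  have hker : LinearMap.ker ((Ideal.Quotient.mkₐ k J).toLinearMap ∘ₗ LinearMap.mulLeft k f) =
      LinearMap.ker (Ideal.Quotient.mkₐ k J).toLinearMap := by
    ext g
    change Ideal.Quotient.mk J (f * g) = 0 ↔ Ideal.Quotient.mk J g = 0
    rw [Ideal.Quotient.eq_zero_iff_mem, Ideal.Quotient.eq_zero_iff_mem]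
    exact ⟨hf g, fun h => Ideal.mul_mem_left _ _ h⟩
  rw [hker] at h1
  rw [mulRank, hilbertFunction]
  omega

/-! ### Hilbert series of complete intersections -/

/-- The Hilbert series of `R / I`, with integer coefficients so that it can be multiplied by
`1 - X ^ d`. -/
noncomputable def hilbertSeries (I : Ideal (MvPolynomial (Fin r) k)) : PowerSeries ℤ :=
  PowerSeries.mk fun n => (hilbertFunction I n : ℤ)

/-- Each member of degree `d` of a regular sequence multiplies the Hilbert series by `1 - X ^ d`. -/
lemma hilbertSeries_ofList {d : ℕ} (rs : List (MvPolynomial (Fin r) k))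
    (hrs : IsWeaklyRegular (MvPolynomial (Fin r) k) rs) (hd : ∀ f ∈ rs, f.IsHomogeneous d) :
    hilbertSeries (Ideal.ofList rs) = (1 - PowerSeries.X ^ d) ^ rs.length *
      hilbertSeries (⊥ : Ideal (MvPolynomial (Fin r) k)) := by
  induction rs using List.reverseRecOn with
  | nil => simp
  | append_singleton rs f ih =>
    rw [isWeaklyRegular_append_iff, isWeaklyRegular_singleton_iff,
      isSMulRegular_quotient_iff_mem_of_smul_mem, smul_eq_mul, Ideal.mul_top] at hrs
    have hf : f.IsHomogeneous d := hd f (by simp)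
    have hrsd : ∀ g ∈ rs, g.IsHomogeneous d := fun g hg => hd g (by simp [hg])
    have hJ : (Ideal.ofList rs).IsHomogeneous (homogeneousSubmodule (Fin r) k) :=
      Ideal.homogeneous_span _ _ fun g hg => ⟨d, hrsd g hg⟩
    rw [List.length_append, List.length_singleton, pow_succ', mul_assoc, ← ih hrs.1 hrsd,
      Ideal.ofList_append, Ideal.ofList_singleton]
    ext n
    rw [sub_mul, one_mul, map_sub, PowerSeries.coeff_X_pow_mul', hilbertSeries, hilbertSeries,
      PowerSeries.coeff_mk, PowerSeries.coeff_mk]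
    split_ifs with hn
    · obtain ⟨i, rfl⟩ := Nat.exists_eq_add_of_le' hn
      rw [Nat.add_sub_cancel, PowerSeries.coeff_mk, ← hilbertFunction_sup_add_mulRank hJ hf i,
        mulRank_of_isSMulRegular hrs.2]
      push_cast
      ring
    · rw [hilbertFunction_sup_of_lt hJ hf (by omega), sub_zero]

lemma hilbertSeries_bot_mul :
    (1 - PowerSeries.X) ^ r * hilbertSeries (⊥ : Ideal (MvPolynomial (Fin r) k)) = 1 := by
  have h := (hilbertSeries_ofList (d := 1) (List.ofFn (X : Fin r → MvPolynomial (Fin r) k))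
    isWeaklyRegular_X (by
      intro f hf
      obtain ⟨i, rfl⟩ := (List.mem_ofFn' _ _).mp hf
      exact isHomogeneous_X k i))
  rw [pow_one, List.length_ofFn, ofList_ofFn] at h
  rw [← h]
  ext n
  rw [hilbertSeries, PowerSeries.coeff_mk, PowerSeries.coeff_one]
  split_ifs with hn
  · subst hn
    rw [hilbertFunction]
    norm_cast
    have h1 : (homogeneousSubmodule (Fin r) k 0).map (Ideal.Quotient.mkₐ k
        (Ideal.span (Set.range (X : Fin r → MvPolynomial (Fin r) k)))).toLinearMap =
        Submodule.span k {1} := by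
      rw [homogeneousSubmodule_zero, Submodule.one_eq_span, Submodule.map_span]
      simp
    rw [h1]
    apply finrank_span_singleton
    intro h0
    have : (1 : MvPolynomial (Fin r) k) ∈
        Ideal.span (Set.range (X : Fin r → MvPolynomial (Fin r) k)) := by
      rw [← Ideal.Quotient.eq_zero_iff_mem, map_one, h0]
    rw [mem_span_X_iff, map_one] at this
    exact one_ne_zero this
  · norm_cast
    exact hilbertFunction_eq_zero_iff.mpr fun f hf => mem_span_X_of_isHomogeneous hf hn

lemma hilbertFunction_bot_two :
    hilbertFunction (⊥ : Ideal (MvPolynomial (Fin r) k)) 2 = (r + 1).choose 2 := by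
  have h := hilbertSeries_bot_mul (k := k) (r := r)
  have h2 : hilbertSeries (⊥ : Ideal (MvPolynomial (Fin r) k)) =
      (PowerSeries.invOneSubPow ℤ r : PowerSeries ℤ) := by
    rw [← PowerSeries.invOneSubPow_inv_eq_one_sub_pow] at h
    rw [← mul_one (PowerSeries.invOneSubPow ℤ r : PowerSeries ℤ), ← h, ← mul_assoc]
    rw [(PowerSeries.invOneSubPow ℤ r).val_inv, one_mul]
  have h3 := congrArg (PowerSeries.coeff 2) h2
  rw [hilbertSeries, PowerSeries.coeff_mk] at h3
  rcases Nat.eq_zero_or_pos r with rfl | hr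
  · rw [PowerSeries.invOneSubPow_zero] at h3
    simpa [PowerSeries.coeff_one] using h3
  · rw [PowerSeries.invOneSubPow_val_eq_mk_sub_one_add_choose_of_pos _ _ hr,
      PowerSeries.coeff_mk] at h3
    have h4 : (r - 1 + 2).choose (r - 1) = (r + 1).choose 2 := by
      rw [Nat.choose_symm_add]
      congr 1
      omega
    rw [h4] at h3
    exact_mod_cast h3

/-- A complete intersection of `r` quadrics has Hilbert series `(1 + X) ^ r`. -/
lemma hilbertFunction_of_isRegularSequenceOfQuadrics {q : Fin r → MvPolynomial (Fin r) k}
    (hq : IsRegularSequenceOfQuadrics q) (i : ℕ) :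
    hilbertFunction (Ideal.span (Set.range q)) i = r.choose i := by
  have h := (hilbertSeries_ofList (d := 2) (List.ofFn q) hq.2.toIsWeaklyRegular (by
      intro f hf
      obtain ⟨i, rfl⟩ := (List.mem_ofFn' _ _).mp hf
      exact hq.1 i))
  have hfac : (1 - PowerSeries.X ^ 2 : PowerSeries ℤ) =
      (1 + PowerSeries.X) * (1 - PowerSeries.X) := by ring
  rw [List.length_ofFn, ofList_ofFn, hfac, mul_pow, mul_assoc, hilbertSeries_bot_mul,
    mul_one] at h
  have h2 := congrArg (PowerSeries.coeff i) h
  have h3 : (1 + PowerSeries.X : PowerSeries ℤ) ^ r =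
      (((1 + Polynomial.X) ^ r : Polynomial ℤ) : PowerSeries ℤ) := by
    simp
  rw [h3, Polynomial.coeff_coe, Polynomial.coeff_one_add_X_pow, hilbertSeries,
    PowerSeries.coeff_mk] at h2
  exact_mod_cast h2

/-! ### Duality in graded algebras with one-dimensional socle -/

lemma hilbertFunction_eq_zero_of_lt {I : Ideal (MvPolynomial (Fin r) k)} {e n : ℕ}
    (he : IsSocleDegree I e) (hn : e < n) : hilbertFunction I n = 0 := by
  by_contra h
  exact absurd (he.2 h) (by omega)

lemma IsSocleDegree.exists_notMem {I : Ideal (MvPolynomial (Fin r) k)} {e : ℕ}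
    (he : IsSocleDegree I e) : ∃ u : MvPolynomial (Fin r) k, u.IsHomogeneous e ∧ u ∉ I := by
  have h := he.1
  rw [Set.mem_ofPred_eq, Ne, hilbertFunction_eq_zero_iff] at h
  push Not at h
  exact h

lemma mk_mem_socle_iff {I : Ideal (MvPolynomial (Fin r) k)} {f : MvPolynomial (Fin r) k} :
    Ideal.Quotient.mk I f ∈ socle I ↔ ∀ i, X i * f ∈ I := by
  simp only [socle, Submodule.mem_iInf, LinearMap.mem_ker, LinearMap.mulLeft_apply, ← map_mul,
    Ideal.Quotient.eq_zero_iff_mem]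

lemma IsSocleDegree.mk_mem_socle {I : Ideal (MvPolynomial (Fin r) k)} {e : ℕ}
    (he : IsSocleDegree I e) {f : MvPolynomial (Fin r) k} (hf : f.IsHomogeneous e) :
    Ideal.Quotient.mk I f ∈ socle I := by
  rw [mk_mem_socle_iff]
  intro i
  refine hilbertFunction_eq_zero_iff.mp (hilbertFunction_eq_zero_of_lt he (n := 1 + e) (by omega))
    _ ((isHomogeneous_X k i).mul hf)

/-- Modulo `I`, every element of the socle is a multiple of any form of top degree not in `I`. -/
lemma IsSocleDegree.exists_sub_smul_mem {I : Ideal (MvPolynomial (Fin r) k)}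
    (hs : Module.finrank k (socle I) = 1) {e : ℕ} (he : IsSocleDegree I e)
    {u : MvPolynomial (Fin r) k} (hu : u.IsHomogeneous e) (huI : u ∉ I)
    {f : MvPolynomial (Fin r) k} (hf : Ideal.Quotient.mk I f ∈ socle I) :
    ∃ c : k, f - c • u ∈ I := by
  have hu0 : (⟨Ideal.Quotient.mk I u, he.mk_mem_socle hu⟩ : socle I) ≠ 0 := by
    intro h
    exact huI (Ideal.Quotient.eq_zero_iff_mem.mp (congrArg Subtype.val h))
  obtain ⟨c, hc⟩ := (finrank_eq_one_iff_of_nonzero' _ hu0).mp hs ⟨_, hf⟩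
  refine ⟨c, Ideal.Quotient.eq_zero_iff_mem.mp ?_⟩
  have hc' : c • Ideal.Quotient.mk I u = Ideal.Quotient.mk I f := congrArg Subtype.val hc
  rw [map_sub, ← hc', sub_eq_zero]
  rfl

/-- A form outside `I` has a multiple of top degree outside `I`. -/
lemma exists_mul_notMem {I : Ideal (MvPolynomial (Fin r) k)}
    (hI : I.IsHomogeneous (homogeneousSubmodule (Fin r) k))
    (hs : Module.finrank k (socle I) = 1) {e : ℕ} (he : IsSocleDegree I e) (n : ℕ) :
    ∀ (i : ℕ) (f : MvPolynomial (Fin r) k), f.IsHomogeneous i → f ∉ I → i + n = e →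
      ∃ g : MvPolynomial (Fin r) k, g.IsHomogeneous n ∧ f * g ∉ I := by
  induction n with
  | zero =>
    intro i f hf hfI hi
    exact ⟨1, isHomogeneous_one _ _, by rwa [mul_one]⟩
  | succ n ih =>
    intro i f hf hfI hi
    obtain ⟨j, hj⟩ : ∃ j, X j * f ∉ I := by
      by_contra! hcon
      obtain ⟨u, hu, huI⟩ := he.exists_notMem
      obtain ⟨c, hc⟩ := he.exists_sub_smul_mem hs hu huI (mk_mem_socle_iff.mpr hcon)
      -- a socle element of degree `i < e` is a multiple of one of degree `e`, hence zero
      have h2 := homogeneousComponent_mem_of_mem hI hc i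
      rw [map_sub, map_smul, homogeneousComponent_self hf,
        homogeneousComponent_of_mem (m := i) hu, if_neg (by omega), smul_zero, sub_zero] at h2
      exact hfI h2
    obtain ⟨g, hg, hgI⟩ := ih (1 + i) (X j * f) ((isHomogeneous_X k j).mul hf) hj (by omega)
    refine ⟨X j * g, ?_, ?_⟩
    · rw [add_comm]
      exact (isHomogeneous_X k j).mul hg
    · rwa [← mul_assoc, mul_comm f]

/-- A functional on the polynomial ring that induces an isomorphism of `[R / I]_e` with `k`. -/
lemma IsSocleDegree.exists_functional {I : Ideal (MvPolynomial (Fin r) k)}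
    (hs : Module.finrank k (socle I) = 1) {e : ℕ} (he : IsSocleDegree I e) :
    ∃ ψ : MvPolynomial (Fin r) k →ₗ[k] k,
      ∀ f : MvPolynomial (Fin r) k, f.IsHomogeneous e → (ψ f = 0 ↔ f ∈ I) := by
  obtain ⟨u, hu, huI⟩ := he.exists_notMem
  have hu0 : Ideal.Quotient.mk I u ≠ 0 := fun h => huI (Ideal.Quotient.eq_zero_iff_mem.mp h)
  obtain ⟨φ, hφ⟩ : ∃ φ : Module.Dual k (MvPolynomial (Fin r) k ⧸ I),
      φ (Ideal.Quotient.mk I u) ≠ 0 := by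
    by_contra! hcon
    exact hu0 ((Module.forall_dual_apply_eq_zero_iff k _).mp hcon)
  have hI : ∀ f ∈ I, φ (Ideal.Quotient.mk I f) = 0 := fun f hf => by
    rw [Ideal.Quotient.eq_zero_iff_mem.mpr hf, map_zero]
  refine ⟨φ ∘ₗ (Ideal.Quotient.mkₐ k I).toLinearMap, fun f hf => ⟨fun h => ?_, hI f⟩⟩
  change φ (Ideal.Quotient.mk I f) = 0 at h
  obtain ⟨c, hc⟩ := he.exists_sub_smul_mem hs hu huI (he.mk_mem_socle hf)
  have h1 := hI _ hc
  have h2 : φ (Ideal.Quotient.mk I (f - c • u)) =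
      φ (Ideal.Quotient.mk I f) - c • φ (Ideal.Quotient.mk I u) := by
    rw [← map_smul, ← map_sub, map_sub (Ideal.Quotient.mk I)]
    rfl
  rw [h2, h, zero_sub, neg_eq_zero, smul_eq_mul] at h1
  have hc0 : c = 0 := (mul_eq_zero.mp h1).resolve_right hφ
  rwa [hc0, zero_smul, sub_zero] at hc

/-- The bilinear form `(a, b) ↦ ψ (f * a * b)` on forms of degrees `i` and `j`. -/
noncomputable def mulForm (ψ : MvPolynomial (Fin r) k →ₗ[k] k) (f : MvPolynomial (Fin r) k)
    (i j : ℕ) : homogeneousSubmodule (Fin r) k i →ₗ[k] homogeneousSubmodule (Fin r) k j →ₗ[k] k :=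
  ((LinearMap.mul k (MvPolynomial (Fin r) k)).compr₂ (ψ ∘ₗ LinearMap.mulLeft k f)).domRestrict₁₂
    (homogeneousSubmodule (Fin r) k i) (homogeneousSubmodule (Fin r) k j)

lemma mulForm_apply (ψ : MvPolynomial (Fin r) k →ₗ[k] k) (f : MvPolynomial (Fin r) k) {i j : ℕ}
    (a : homogeneousSubmodule (Fin r) k i) (b : homogeneousSubmodule (Fin r) k j) :
    mulForm ψ f i j a b = ψ (f * (a.1 * b.1)) := rfl

lemma finrank_range_mulForm {I : Ideal (MvPolynomial (Fin r) k)}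
    (hI : I.IsHomogeneous (homogeneousSubmodule (Fin r) k))
    (hs : Module.finrank k (socle I) = 1) {e : ℕ} (he : IsSocleDegree I e)
    {ψ : MvPolynomial (Fin r) k →ₗ[k] k}
    (hψ : ∀ f : MvPolynomial (Fin r) k, f.IsHomogeneous e → (ψ f = 0 ↔ f ∈ I))
    {f : MvPolynomial (Fin r) k} {d i j : ℕ} (hf : f.IsHomogeneous d) (hij : d + i + j = e) :
    Module.finrank k (LinearMap.range (mulForm ψ f i j)) = mulRank I f i := by
  set F := ((Ideal.Quotient.mkₐ k I).toLinearMap ∘ₗ LinearMap.mulLeft k f).domRestrict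
    (homogeneousSubmodule (Fin r) k i) with hF
  have hker : LinearMap.ker (mulForm ψ f i j) = LinearMap.ker F := by
    ext a
    have h1 : F a = 0 ↔ f * a.1 ∈ I := Ideal.Quotient.eq_zero_iff_mem
    have hb : ∀ b : homogeneousSubmodule (Fin r) k j,
        (f * (a.1 * b.1)).IsHomogeneous e := by
      intro b
      rw [← mul_assoc, ← hij]
      exact (hf.mul a.2).mul b.2
    rw [LinearMap.mem_ker, LinearMap.mem_ker, h1]
    constructor
    · intro h
      by_contra hcon
      obtain ⟨g, hg, hgI⟩ := exists_mul_notMem hI hs he j (d + i) _ (hf.mul a.2) hcon hij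
      have h2 := LinearMap.congr_fun h ⟨g, hg⟩
      rw [mulForm_apply, LinearMap.zero_apply, hψ _ (hb _), ← mul_assoc] at h2
      exact hgI h2
    · intro h
      ext b
      rw [mulForm_apply, LinearMap.zero_apply, hψ _ (hb _), ← mul_assoc]
      exact Ideal.mul_mem_right _ _ h
  have h1 := LinearMap.finrank_range_add_finrank_ker (mulForm ψ f i j)
  have h2 := LinearMap.finrank_range_add_finrank_ker F
  have h3 : Module.finrank k (LinearMap.range F) = mulRank I f i := by
    rw [hF, LinearMap.range_domRestrict, mulRank]
  rw [hker] at h1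
  omega

/-- Multiplication by a form `f` is self-adjoint for the duality pairing, so its ranks are
symmetric. -/
lemma mulRank_eq_mulRank {I : Ideal (MvPolynomial (Fin r) k)}
    (hI : I.IsHomogeneous (homogeneousSubmodule (Fin r) k))
    (hs : Module.finrank k (socle I) = 1) {e : ℕ} (he : IsSocleDegree I e)
    {f : MvPolynomial (Fin r) k} {d i j : ℕ} (hf : f.IsHomogeneous d) (hij : d + i + j = e) :
    mulRank I f i = mulRank I f j := by
  obtain ⟨ψ, hψ⟩ := he.exists_functional hs
  rw [← finrank_range_mulForm hI hs he hψ hf hij,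
    ← finrank_range_mulForm hI hs he hψ hf (i := j) (j := i) (by omega), ← finrank_range_flip]
  have hflip : (mulForm ψ f i j).flip = mulForm ψ f j i := by
    refine LinearMap.ext₂ fun a b => ?_
    rw [LinearMap.flip_apply, mulForm_apply, mulForm_apply, mul_comm a.1]
  rw [hflip]

/-- The Hilbert function of a Gorenstein algebra is symmetric. -/
lemma hilbertFunction_symm {I : Ideal (MvPolynomial (Fin r) k)}
    (hI : I.IsHomogeneous (homogeneousSubmodule (Fin r) k))
    (hs : Module.finrank k (socle I) = 1) {e : ℕ} (he : IsSocleDegree I e) {i j : ℕ}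
    (hij : i + j = e) : hilbertFunction I i = hilbertFunction I j := by
  rw [← mulRank_one, ← mulRank_one,
    mulRank_eq_mulRank hI hs he (isHomogeneous_one (Fin r) k) (i := i) (j := j) (by omega)]

/-! ### Minimal generators of degree two -/

/-- If `I` has no nonzero elements of degree less than `2`, then any set of homogeneous generators
of `I` contains enough quadrics to span the degree `2` part of `I` over `k`. -/
lemma mem_span_quadrics {I : Ideal (MvPolynomial (Fin r) k)}
    (hlow : ∀ f ∈ I, ∀ d < 2, f.IsHomogeneous d → f = 0) {G : Set (MvPolynomial (Fin r) k)}
    (hG : IsMinimalGenerators I G) {f : MvPolynomial (Fin r) k} (hf : f ∈ I)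
    (hf2 : f.IsHomogeneous 2) : f ∈ Submodule.span k {g ∈ G | g.IsHomogeneous 2} := by
  have hf' := hf
  rw [← hG.span_eq, Ideal.span, Submodule.mem_span_set] at hf'
  obtain ⟨c, hc, rfl⟩ := hf'
  rw [← homogeneousComponent_self hf2, Finsupp.sum, map_sum]
  refine Submodule.sum_mem _ fun g hg => ?_
  have hgG : g ∈ G := hc hg
  obtain ⟨d, hd⟩ := hG.isHomogeneous g hgG
  rw [smul_eq_mul, mul_comm]
  rcases lt_trichotomy d 2 with hd2 | rfl | hd2
  · rw [hlow g (hG.span_eq ▸ Ideal.subset_span hgG) d hd2 hd, zero_mul, map_zero]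
    exact Submodule.zero_mem _
  · have h := homogeneousComponent_mul_of_isHomogeneous (g := c g) hd 0
    rw [zero_add] at h
    rw [h, homogeneousComponent_zero, mul_comm, ← smul_eq_C_mul]
    exact Submodule.smul_mem _ _ (Submodule.subset_span ⟨hgG, hd⟩)
  · rw [homogeneousComponent_mul_of_lt hd hd2]
    exact Submodule.zero_mem _

lemma linearIndepOn_quadrics {I : Ideal (MvPolynomial (Fin r) k)}
    {G : Set (MvPolynomial (Fin r) k)} (hG : IsMinimalGenerators I G) :
    LinearIndepOn k id {g ∈ G | g.IsHomogeneous 2} := by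
  rw [linearIndepOn_iff_notMem_span]
  intro g hg hmem
  rw [Set.image_id, id] at hmem
  refine hG.minimal (G \ {g}) (Set.sdiff_singleton_ssubset.mpr hg.1) (le_antisymm ?_ ?_)
  · rw [← hG.span_eq]
    exact Ideal.span_mono Set.sdiff_subset
  · conv_lhs => rw [← hG.span_eq]
    rw [Ideal.span_le]
    intro x hx
    by_cases hxg : x = g
    · subst hxg
      have hle : Submodule.span k ({g ∈ G | g.IsHomogeneous 2} \ {x}) ≤
          (Ideal.span (G \ {x})).restrictScalars k := by
        rw [Submodule.span_le]
        intro y hy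
        exact Ideal.subset_span ⟨hy.1.1, hy.2⟩
      exact hle hmem
    · exact Ideal.subset_span ⟨hx, hxg⟩

lemma hilbertFunction_two_add_ncard {I : Ideal (MvPolynomial (Fin r) k)}
    (hlow : ∀ f ∈ I, ∀ d < 2, f.IsHomogeneous d → f = 0) {G : Set (MvPolynomial (Fin r) k)}
    (hG : IsMinimalGenerators I G) :
    hilbertFunction I 2 + {g ∈ G | g.IsHomogeneous 2}.ncard = (r + 1).choose 2 := by
  have hspan : homogeneousSubmodule (Fin r) k 2 ⊓
      LinearMap.ker (Ideal.Quotient.mkₐ k I).toLinearMap =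
      Submodule.span k {g ∈ G | g.IsHomogeneous 2} := by
    apply le_antisymm
    · rintro f ⟨hf2, hf⟩
      exact mem_span_quadrics hlow hG (Ideal.Quotient.eq_zero_iff_mem.mp hf) hf2
    · rw [Submodule.span_le]
      rintro g ⟨hg, hg2⟩
      exact ⟨hg2, Ideal.Quotient.eq_zero_iff_mem.mpr (hG.span_eq ▸ Ideal.subset_span hg)⟩
  have hcard : Module.finrank k (Submodule.span k {g ∈ G | g.IsHomogeneous 2}) =
      {g ∈ G | g.IsHomogeneous 2}.ncard := by
    rw [Module.finrank, rank_span_set (linearIndepOn_quadrics hG)]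
    rfl
  have h1 := finrank_map_add_finrank_inf_ker (homogeneousSubmodule (Fin r) k 2)
    (Ideal.Quotient.mkₐ k I).toLinearMap
  have h2 := finrank_map_add_finrank_inf_ker (homogeneousSubmodule (Fin r) k 2)
    (Ideal.Quotient.mkₐ k (⊥ : Ideal (MvPolynomial (Fin r) k))).toLinearMap
  have hbot : LinearMap.ker
      (Ideal.Quotient.mkₐ k (⊥ : Ideal (MvPolynomial (Fin r) k))).toLinearMap = ⊥ := by
    rw [eq_bot_iff]
    intro f hf
    exact Ideal.Quotient.eq_zero_iff_mem.mp hf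
  rw [hbot, inf_bot_eq, finrank_bot, add_zero] at h2
  rw [hspan, hcard, ← h2] at h1
  rw [← hilbertFunction_bot_two (k := k)]
  exact h1

/-! ### Almost complete intersections of quadrics -/

lemma isSocleDegree_of_isRegularSequenceOfQuadrics {q : Fin r → MvPolynomial (Fin r) k}
    (hq : IsRegularSequenceOfQuadrics q) : IsSocleDegree (Ideal.span (Set.range q)) r := by
  constructor
  · rw [Set.mem_ofPred_eq, hilbertFunction_of_isRegularSequenceOfQuadrics hq, Nat.choose_self]
    exact one_ne_zero
  · intro n hn
    by_contra hcon
    rw [Set.mem_ofPred_eq, hilbertFunction_of_isRegularSequenceOfQuadrics hq,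
      Nat.choose_eq_zero_of_lt (by omega)] at hn
    exact hn rfl

lemma isHomogeneous_span_of_isRegularSequenceOfQuadrics {q : Fin r → MvPolynomial (Fin r) k}
    (hq : IsRegularSequenceOfQuadrics q) :
    (Ideal.span (Set.range q)).IsHomogeneous (homogeneousSubmodule (Fin r) k) := by
  apply Ideal.homogeneous_span
  rintro _ ⟨i, rfl⟩
  exact ⟨2, hq.1 i⟩

lemma finrank_socle_of_isRegularSequenceOfQuadrics {q : Fin r → MvPolynomial (Fin r) k}
    (hq : IsRegularSequenceOfQuadrics q) :
    Module.finrank k (socle (Ideal.span (Set.range q))) = 1 :=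
  finrank_socle_eq_one hq.2.toIsWeaklyRegular
    fun i => mem_span_X_of_isHomogeneous (hq.1 i) two_ne_zero

/-- No polynomial `P` satisfies `P * (1 - X ^ (c + 2)) = (1 - X ^ 2) * (1 + X) ^ r` with `c > 0`:
a primitive root of unity of order `c + 2` is not a root of the right-hand side. -/
lemma not_exists_mul_one_sub_X_pow {c : ℕ} (hc : 0 < c) (P : Polynomial ℂ) :
    P * (1 - Polynomial.X ^ (c + 2)) ≠ (1 - Polynomial.X ^ 2) * (1 + Polynomial.X) ^ r := by
  intro h
  have hζ := Complex.isPrimitiveRoot_exp (c + 2) (by omega)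
  generalize Complex.exp _ = ζ at hζ
  have h2 : ζ ^ 2 ≠ 1 := hζ.pow_ne_one_of_pos_of_lt (by omega) (by omega)
  have h3 := congrArg (Polynomial.eval ζ) h
  simp only [Polynomial.eval_mul, Polynomial.eval_sub, Polynomial.eval_one, Polynomial.eval_pow,
    Polynomial.eval_X, Polynomial.eval_add, hζ.pow_eq_one, sub_self, mul_zero] at h3
  rcases mul_eq_zero.mp h3.symm with h4 | h4
  · exact h2 (sub_eq_zero.mp h4).symm
  · apply h2
    rw [eq_neg_of_add_eq_zero_right (eq_zero_of_pow_eq_zero h4)]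
    norm_num

/-- An ideal of socle degree `e < r` generated by a regular sequence of `r` quadrics and one further
quadric is not Gorenstein. Duality in `R / (q)` and in `R / I` turns the exact sequence
relating them into `H_I = (1 - X ^ 2) (1 + X) ^ r + X ^ (r - e + 2) H_I`. -/
lemma false_of_sup_span_singleton {q : Fin r → MvPolynomial (Fin r) k}
    (hq : IsRegularSequenceOfQuadrics q) {I : Ideal (MvPolynomial (Fin r) k)}
    (hI : I.IsHomogeneous (homogeneousSubmodule (Fin r) k))
    (hs : Module.finrank k (socle I) = 1) {e : ℕ} (he : IsSocleDegree I e) (her : e < r)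
    {f : MvPolynomial (Fin r) k} (hf : f.IsHomogeneous 2)
    (hIf : Ideal.span (Set.range q) ⊔ Ideal.span {f} = I) : False := by
  set J := Ideal.span (Set.range q) with hJdef
  have hJ : J.IsHomogeneous (homogeneousSubmodule (Fin r) k) :=
    isHomogeneous_span_of_isRegularSequenceOfQuadrics hq
  have hJs : Module.finrank k (socle J) = 1 := finrank_socle_of_isRegularSequenceOfQuadrics hq
  have hJr : IsSocleDegree J r := isSocleDegree_of_isRegularSequenceOfQuadrics hq
  have hJh : ∀ n, hilbertFunction J n = r.choose n :=
    hilbertFunction_of_isRegularSequenceOfQuadrics hq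
  obtain ⟨c, rfl⟩ := Nat.exists_eq_add_of_lt her
  have hlt : ∀ n < 2, hilbertFunction I n = (e + c + 1).choose n := fun n hn => by
    rw [← hIf, hilbertFunction_sup_of_lt hJ hf hn, hJh]
  have hge : ∀ i, hilbertFunction I (i + 2) + mulRank J f i = (e + c + 1).choose (i + 2) :=
    fun i => by rw [← hIf, hilbertFunction_sup_add_mulRank hJ hf, hJh]
  have hdual : ∀ i ≤ e + c + 1,
      mulRank J f i + hilbertFunction I (e + c + 1 - i) = (e + c + 1).choose i := by
    intro i hi
    by_cases hi2 : i + 2 ≤ e + c + 1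
    · obtain ⟨j, hj⟩ := Nat.exists_eq_add_of_le hi2
      rw [mulRank_eq_mulRank hJ hJs hJr hf (j := j) (by omega), add_comm,
        show e + c + 1 - i = j + 2 by omega, hge, ← Nat.choose_symm hi]
      congr 1
      omega
    -- for `i ≥ r - 1` the rank is zero, and `I` agrees with `(q)` in degree `r - i < 2`
    · have h0 : mulRank J f i = 0 := by
        have := hge i
        rw [Nat.choose_eq_zero_of_lt (by omega)] at this
        omega
      rw [h0, zero_add, hlt _ (by omega), Nat.choose_symm hi]
  have hsymm : ∀ i ≤ e + c + 1, hilbertFunction I (e + c + 1 - i) =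
      if c + 1 ≤ i then hilbertFunction I (i - (c + 1)) else 0 := by
    intro i hi
    split_ifs with hci
    · exact hilbertFunction_symm hI hs he (by omega)
    · exact hilbertFunction_eq_zero_of_lt he (by omega)
  have hrank : ∀ i, mulRank J f i +
      (if c + 1 ≤ i then hilbertFunction I (i - (c + 1)) else 0) = (e + c + 1).choose i := by
    intro i
    by_cases hi : i ≤ e + c + 1
    · rw [← hsymm i hi, hdual i hi]
    · have h1 := hge i
      rw [Nat.choose_eq_zero_of_lt (by omega)] at h1
      rw [if_pos (by omega), hilbertFunction_eq_zero_of_lt he (by omega),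
        Nat.choose_eq_zero_of_lt (by omega)]
      omega
  let P : Polynomial ℂ :=
    ∑ n ∈ Finset.range (e + 1), Polynomial.monomial n (hilbertFunction I n : ℂ)
  have hP : ∀ n, P.coeff n = (hilbertFunction I n : ℂ) := by
    intro n
    simp only [P, Polynomial.finsetSum_coeff, Polynomial.coeff_monomial]
    rw [Finset.sum_ite_eq']
    split_ifs with hn
    · rfl
    · rw [hilbertFunction_eq_zero_of_lt he (by simpa using hn), Nat.cast_zero]
  refine not_exists_mul_one_sub_X_pow (r := e + c + 1) (Nat.succ_pos c) P ?_
  ext n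
  rw [mul_sub, mul_one, sub_mul, one_mul, Polynomial.coeff_sub, Polynomial.coeff_sub,
    Polynomial.coeff_mul_X_pow', Polynomial.coeff_X_pow_mul', Polynomial.coeff_one_add_X_pow, hP]
  rcases lt_or_ge n 2 with hn | hn
  · rw [if_neg (by omega), if_neg (by omega), hlt n hn]
  · obtain ⟨i, rfl⟩ := Nat.exists_eq_add_of_le' hn
    have h1 : (hilbertFunction I (i + 2) : ℂ) + mulRank J f i = (e + c + 1).choose (i + 2) := by
      exact_mod_cast hge i
    have h2 : (mulRank J f i : ℂ) +
        (if c + 1 ≤ i then (hilbertFunction I (i - (c + 1)) : ℂ) else 0) =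
          (e + c + 1).choose i := by
      exact_mod_cast hrank i
    rw [if_pos hn, Nat.add_sub_cancel, Polynomial.coeff_one_add_X_pow, ← h1, ← h2, hP]
    simp only [Nat.succ_eq_add_one, Nat.add_le_add_iff_right,
      show i + 2 - (c + 1 + 2) = i - (c + 1) by omega]
    ring

/-! ### Gorenstein ideals containing a regular sequence of quadrics -/

/-- A homogeneous ideal of socle degree `r` that contains a regular sequence of `r` quadrics is
generated by it: any form outside the complete intersection has a multiple that spans its socle. -/
lemma eq_span_of_isSocleDegree {q : Fin r → MvPolynomial (Fin r) k}
    (hq : IsRegularSequenceOfQuadrics q) {I : Ideal (MvPolynomial (Fin r) k)}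
    (hI : I.IsHomogeneous (homogeneousSubmodule (Fin r) k)) (he : IsSocleDegree I r)
    (hqI : Ideal.span (Set.range q) ≤ I) : Ideal.span (Set.range q) = I := by
  refine le_antisymm hqI fun f hf => ?_
  have hJ := isHomogeneous_span_of_isRegularSequenceOfQuadrics hq
  have hJr := isSocleDegree_of_isRegularSequenceOfQuadrics hq
  rw [mem_iff_homogeneousComponent_mem hJ]
  intro n
  by_contra hcon
  have hn : n ≤ r := by
    by_contra hlt
    exact hcon (hilbertFunction_eq_zero_iff.mp (hilbertFunction_eq_zero_of_lt hJr (by omega)) _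
      (homogeneousComponent_isHomogeneous n f))
  obtain ⟨g, hg, hgJ⟩ := exists_mul_notMem hJ (finrank_socle_of_isRegularSequenceOfQuadrics hq)
    hJr (r - n) n _ (homogeneousComponent_isHomogeneous n f) hcon (by omega)
  have hgI : homogeneousComponent n f * g ∈ I :=
    Ideal.mul_mem_right _ _ (homogeneousComponent_mem_of_mem hI hf n)
  have hdeg : (homogeneousComponent n f * g).IsHomogeneous r := by
    have := (homogeneousComponent_isHomogeneous n f).mul hg
    rwa [Nat.add_sub_cancel' hn] at this
  have h1 : hilbertFunction I r = hilbertFunction (Ideal.span (Set.range q)) r := by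
    apply le_antisymm (hilbertFunction_anti hqI r)
    rw [hilbertFunction_of_isRegularSequenceOfQuadrics hq, Nat.choose_self]
    exact Nat.one_le_iff_ne_zero.mpr he.1
  exact hgJ (mem_of_hilbertFunction_eq hqI h1 hgI hdeg)

/-- If all minimal generators are quadrics and there is one more of them than in the complete
intersection, the ideal is an almost complete intersection. -/
lemma exists_sup_span_singleton_eq {q : Fin r → MvPolynomial (Fin r) k}
    (hq : IsRegularSequenceOfQuadrics q) {I : Ideal (MvPolynomial (Fin r) k)}
    (hqI : Ideal.span (Set.range q) ≤ I) {G : Set (MvPolynomial (Fin r) k)}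
    (hG : Ideal.span G = I) (hquad : ∀ g ∈ G, g.IsHomogeneous 2)
    (h2 : hilbertFunction I 2 + 1 = r.choose 2) :
    ∃ f : MvPolynomial (Fin r) k, f.IsHomogeneous 2 ∧
      Ideal.span (Set.range q) ⊔ Ideal.span {f} = I := by
  have hJ := isHomogeneous_span_of_isRegularSequenceOfQuadrics hq
  have hJ2 := hilbertFunction_of_isRegularSequenceOfQuadrics hq 2
  obtain ⟨f, hfG, hfJ⟩ : ∃ f ∈ G, f ∉ Ideal.span (Set.range q) := by
    by_contra! hcon
    have h : I ≤ Ideal.span (Set.range q) := by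
      rw [← hG]
      exact Ideal.span_le.mpr hcon
    have := hilbertFunction_anti h 2
    omega
  have hf := hquad f hfG
  have hle : Ideal.span (Set.range q) ⊔ Ideal.span {f} ≤ I :=
    sup_le hqI ((Ideal.span_singleton_le_iff_mem I).mpr (hG ▸ Ideal.subset_span hfG))
  refine ⟨f, hf, le_antisymm hle ?_⟩
  have hrank : mulRank (Ideal.span (Set.range q)) f 0 ≠ 0 := by
    rw [mulRank, Ne, Submodule.finrank_eq_zero, Submodule.eq_bot_iff]
    intro h
    apply hfJ
    have h1 := h _ ⟨1, isHomogeneous_one _ _, rfl⟩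
    rw [← Ideal.Quotient.eq_zero_iff_mem, ← mul_one f]
    exact h1
  have hsum := hilbertFunction_sup_add_mulRank hJ hf 0
  have hanti := hilbertFunction_anti hle 2
  rw [zero_add] at hsum
  conv_lhs => rw [← hG]
  refine Ideal.span_le.mpr fun g hg => ?_
  exact mem_of_hilbertFunction_eq hle (by omega) (hG ▸ Ideal.subset_span hg) (hquad g hg)

end GorensteinQuadrics

open GorensteinQuadrics MvPolynomial

theorem mainTheorem2 {k : Type*} [Field k] (r : ℕ) (I : Ideal (MvPolynomial (Fin r) k))
    (hI : GorensteinQuadrics.IsArtinianGorenstein I)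
    (hlin : GorensteinQuadrics.ContainsNoLinearForm I)
    (hreg : GorensteinQuadrics.ContainsRegularSequenceOfQuadrics I)
    (e : ℕ) (he : GorensteinQuadrics.IsSocleDegree I e)
    (G : Set (MvPolynomial (Fin r) k)) (hG : GorensteinQuadrics.IsMinimalGenerators I G)
    (ν : ℕ) (hν : ν = {g ∈ G | g.IsHomogeneous 2}.ncard) :
    (GorensteinQuadrics.hilbertFunction I 2 : ℤ) = ((r + 1).choose 2 : ℤ) - (ν : ℤ) ∧
    r ≤ ν ∧
    e ≤ r ∧
    (e = r ↔ GorensteinQuadrics.IsCompleteIntersectionOfQuadrics I) ∧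
    (e = r ↔ ν = r ∧ ∀ g ∈ G, g.IsHomogeneous 2) ∧
    (e = r → ∀ i : ℕ, GorensteinQuadrics.hilbertFunction I i = r.choose i) ∧
    (¬ GorensteinQuadrics.IsCompleteIntersectionOfQuadrics I → e < r) ∧
    ((∀ g ∈ G, g.IsHomogeneous 2) →
      ν ≠ r + 1 ∧
      (GorensteinQuadrics.hilbertFunction I 2 : ℤ) ≠ (r.choose 2 : ℤ) - 1) := by
  obtain ⟨q, hq, hqI⟩ := hreg
  have hJI : Ideal.span (Set.range q) ≤ I := by
    rw [Ideal.span_le]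
    rintro _ ⟨i, rfl⟩
    exact hqI i
  have hIhom := hI.isHomogeneous
  have hs := hI.finrank_socle
  have hJh := hilbertFunction_of_isRegularSequenceOfQuadrics hq
  have htop : I ≠ ⊤ := by
    rintro rfl
    exact he.1 (hilbertFunction_eq_zero_iff.mpr fun f _ => Submodule.mem_top)
  have hlow : ∀ f ∈ I, ∀ d < 2, f.IsHomogeneous d → f = 0 := by
    intro f hf d hd hfd
    interval_cases d
    · have hC := homogeneousComponent_self hfd
      rw [homogeneousComponent_zero] at hC
      by_contra hf0
      refine htop (Ideal.eq_top_of_isUnit_mem I hf ?_)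
      rw [← hC, isUnit_map_iff]
      refine IsUnit.mk0 _ fun h0 => hf0 ?_
      rw [← hC, h0, C_0]
    · exact hlin f hf hfd
  have h1 : hilbertFunction I 2 + ν = (r + 1).choose 2 := by
    rw [hν]
    exact hilbertFunction_two_add_ncard hlow hG
  have hchoose : (r + 1).choose 2 = r.choose 2 + r := by
    rw [Nat.choose_succ_succ' r 1, Nat.choose_one_right, add_comm]
  have hI2 : hilbertFunction I 2 ≤ r.choose 2 := hJh 2 ▸ hilbertFunction_anti hJI 2
  have her : e ≤ r := by
    by_contra hcon
    have h2 := hilbertFunction_anti hJI e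
    rw [hJh, Nat.choose_eq_zero_of_lt (by omega)] at h2
    exact he.1 (Nat.le_zero.mp h2)
  have heq : e = r → Ideal.span (Set.range q) = I := by
    rintro rfl
    exact eq_span_of_isSocleDegree hq hIhom he hJI
  have hCI : e = r ↔ IsCompleteIntersectionOfQuadrics I := by
    refine ⟨fun h => ⟨q, hq, heq h⟩, ?_⟩
    rintro ⟨q', hq', rfl⟩
    exact he.unique (isSocleDegree_of_isRegularSequenceOfQuadrics hq')
  have hquad_le : (∀ g ∈ G, g.IsHomogeneous 2) → hilbertFunction I 2 = r.choose 2 →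
      I ≤ Ideal.span (Set.range q) := by
    intro hquad h2
    conv_lhs => rw [← hG.span_eq]
    exact Ideal.span_le.mpr fun g hg => mem_of_hilbertFunction_eq hJI (h2.trans (hJh 2).symm)
      (hG.span_eq ▸ Ideal.subset_span hg) (hquad g hg)
  have hν_ne : (∀ g ∈ G, g.IsHomogeneous 2) → ν ≠ r + 1 := by
    intro hquad hνr
    obtain ⟨f, hf, hIf⟩ := exists_sup_span_singleton_eq hq hJI hG.span_eq hquad (by omega)
    have hlt : e < r := by
      refine lt_of_le_of_ne her fun h => ?_
      have h2 := hJh 2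
      rw [heq h] at h2
      omega
    exact false_of_sup_span_singleton hq hIhom hs he hlt hf hIf
  refine ⟨by omega, by omega, her, hCI, ⟨fun h => ?_, ?_⟩, ?_, ?_, ?_⟩
  · have h2 := hJh 2
    rw [heq h] at h2
    refine ⟨by omega, ?_⟩
    -- the quadrics in `G` already generate, so by minimality they are all of `G`
    by_contra hcon
    refine hG.minimal {g ∈ G | g.IsHomogeneous 2}
      ⟨Set.sep_subset _ _, fun hsub => hcon fun g hg => (hsub hg).2⟩ (le_antisymm ?_ ?_)
    · rw [← hG.span_eq]
      exact Ideal.span_mono (Set.sep_subset _ _)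
    · conv_lhs => rw [← heq h]
      rw [Ideal.span_le]
      rintro _ ⟨i, rfl⟩
      exact Submodule.span_le_restrictScalars k (MvPolynomial (Fin r) k) _
        (mem_span_quadrics hlow hG (hqI i) (hq.1 i))
  · rintro ⟨hνr, hquad⟩
    exact hCI.mpr ⟨q, hq, le_antisymm hJI (hquad_le hquad (by omega))⟩
  · intro h i
    rw [← heq h, hJh]
  · intro h
    exact lt_of_le_of_ne her fun h' => h (hCI.mp h')
  · intro hquad
    have := hν_ne hquad
    exact ⟨this, by omega⟩
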